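/- Let $k\ge 0$ and $n\ge 1$ be integers, $A\in\mathbb{R}^{k\times n}$, $y\in\mathbb{R}^k$, $\lambda\ge 0$ and $\mu>0$. Write $\mathbf 1\in\mathbb{R}^n$ for the all-ones vector, $\iota_S$ for the indicator function of a set $S$ ($0$ on $S$, $+\infty$ off $S$), and $\mathrm{soft}(\nu,\tau)$ for the componentwise soft threshold $\mathrm{sign}(\nu_i)\max\{|\nu_i|-\tau,0\}$. Put $$f_1(x)=\tfrac12\|Ax-y\|_2^2+\iota_{\{1\}}(\mathbf 1^Tx),\qquad f_2(x)=\lambda\|x\|_1+\iota_{\mathbb{R}^n_+}(x),\qquad F=f_1+f_2 .$$ 1. $f_1$ and $f_2$ are proper, convex and lower semicontinuous. $F:\mathbb{R}^n\to\mathbb{R}\cup\{+\infty\}$ is proper, convex, lower semicontinuous and coercive ($F(x)\to+\infty$ as $\|x\|\to\infty$), and it has a minimizer. Its minimizers are exactly the solutions of the constrained sparse regression (CSR) problem of minimizing $\tfrac12\|Ax-y\|_2^2+\lambda\|x\|_1$ subject to $x\ge 0$, $\mathbf 1^Tx=1$; for $\lambda=0$ these are exactly the solutions of the constrained least squares (CLS)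 problem of minimizing $\tfrac12\|Ax-y\|_2^2$ under the same constraints. 2. Let $B=A^TA+\mu I$. Then $B$ is invertible and $\mathbf 1^TB^{-1}\mathbf 1\ne 0$, so that $C=B^{-1}\mathbf 1(\mathbf 1^TB^{-1}\mathbf 1)^{-1}$ is defined. For all $u,d\in\mathbb{R}^n$, with $w=A^Ty+\mu(u+d)$, the function $x\mapsto f_1(x)+\tfrac{\mu}{2}\|x-u-d\|_2^2$ has the unique minimizer $B^{-1}w-C(\mathbf 1^TB^{-1}w-1)$. For all $x,d\in\mathbb{R}^n$, with $\nu=x-d$, the function $u\mapsto f_2(u)+\tfrac{\mu}{2}\|x-u-d\|_2^2$ has the unique minimizer $\max\{0,\mathrm{soft}(\nu,\lambda/\mu)\}$ (componentwise maximum). 3. Let $u_0,d_0\in\mathbb{R}^n$ be arbitrary, and let the SUnSAL iterates be defined for $j\ge 0$ by $$w_j=A^Ty+\mu(u_j+d_j),\qquad x_{j+1}=B^{-1}w_j-C(\mathbf 1^TB^{-1}w_j-1),$$ $$u_{j+1}=\max\{0,\mathrm{soft}(x_{j+1}-d_j,\lambda/\mu)\},\qquad d_{j+1}=d_j-(x_{j+1}-u_{j+1}).$$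 Then these are iterates of the alternating direction method of multipliers (ADMM) for $\min_x f_1(x)+f_2(Gx)$ with $G=I$: for every $j\ge0$, $x_{j+1}$ minimizes $f_1(x)+\tfrac{\mu}{2}\|x-u_j-d_j\|_2^2$ over $x$, $u_{j+1}$ minimizes $f_2(u)+\tfrac{\mu}{2}\|x_{j+1}-u-d_j\|_2^2$ over $u$, and $d_{j+1}=d_j-(x_{j+1}-u_{j+1})$. Moreover there is a minimizer $x^\ast$ of $F$ such that $x_j\to x^\ast$ and $u_j\to x^\ast$ as $j\to\infty$. -/

import Mathlib

open Filter Topology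
open scoped Matrix

noncomputable section

namespace SUnSAL

/-- `ℝⁿ` with the Euclidean norm. -/
abbrev E (n : ℕ) : Type := EuclideanSpace ℝ (Fin n)

/-- Matrix-vector product on Euclidean spaces. -/
def mv {p n : ℕ} (M : Matrix (Fin p) (Fin n) ℝ) (x : E n) : E p :=
  WithLp.toLp 2 (M *ᵥ x.ofLp)

/-- The all-ones vector. -/
def ones (n : ℕ) : E n := WithLp.toLp 2 (fun _ => 1)

/-- `1ᵀ x`, the sum of the coordinates. -/
def coordSum {n : ℕ} (x : E n) : ℝ := ∑ i, x i

/-- The `ℓ₁` norm. -/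
def l1norm {n : ℕ} (x : E n) : ℝ := ∑ i, |x i|

/-! ### Extended-real-valued functions -/

open Classical in
/-- The convex-analytic indicator function: `0` on `S`, `+∞` off `S`. -/
def indic {X : Type*} (S : Set X) (x : X) : EReal := if x ∈ S then 0 else ⊤

/-- Proper: not identically `+∞`, and never `-∞`. -/
def IsProper {X : Type*} (f : X → EReal) : Prop :=
  (∃ x, f x ≠ ⊤) ∧ ∀ x, f x ≠ ⊥

/-- Convex: the epigraph, a subset of `ℝⁿ × ℝ`, is convex. -/
def IsConvexFun {n : ℕ} (f : E n → EReal) : Prop :=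
  Convex ℝ {q : E n × ℝ | f q.1 ≤ (q.2 : EReal)}

/-- Coercive: `f x → +∞` as `‖x‖ → ∞`. -/
def IsCoerciveFun {n : ℕ} (f : E n → EReal) : Prop :=
  Tendsto f (Bornology.cobounded (E n)) (𝓝 ⊤)

/-- The set of global minimizers. -/
def argmin {X : Type*} (f : X → EReal) : Set X := {x | ∀ z, f x ≤ f z}

/-! ### ADMM for `min f₁ x + f₂ (G x)` -/

/-- Objective of the first ADMM sub-problem. -/
def admmXObj {n p : ℕ} (f₁ : E n → EReal) (G : Matrix (Fin p) (Fin n) ℝ) (μ : ℝ)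
    (u d : E p) (z : E n) : EReal :=
  f₁ z + ((μ / 2 * ‖mv G z - u - d‖ ^ 2 : ℝ) : EReal)

/-- Objective of the second ADMM sub-problem. -/
def admmUObj {n p : ℕ} (f₂ : E p → EReal) (G : Matrix (Fin p) (Fin n) ℝ) (μ : ℝ)
    (x : E n) (d : E p) (v : E p) : EReal :=
  f₂ v + ((μ / 2 * ‖mv G x - v - d‖ ^ 2 : ℝ) : EReal)

/-- The three sequences are generated by ADMM (`x 0` plays no role). -/
structure IsADMM {n p : ℕ} (f₁ : E n → EReal) (f₂ : E p → EReal)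
    (G : Matrix (Fin p) (Fin n) ℝ) (μ : ℝ)
    (x : ℕ → E n) (u d : ℕ → E p) : Prop where
  x_step : ∀ j, x (j + 1) ∈ argmin (admmXObj f₁ G μ (u j) (d j))
  u_step : ∀ j, u (j + 1) ∈ argmin (admmUObj f₂ G μ (x (j + 1)) (d j))
  d_step : ∀ j, d (j + 1) = d j - (mv G (x (j + 1)) - u (j + 1))

/-! ### Constrained sparse regression -/

variable {k n : ℕ}

/-- `L(x) = (1/2)‖Ax - y‖₂² + λ‖x‖₁`. -/
def csrLoss (A : Matrix (Fin k) (Fin n) ℝ) (y : E k) (lam : ℝ) (x : E n) : ℝ :=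
  1 / 2 * ‖mv A x - y‖ ^ 2 + lam * l1norm x

/-- `(1/2)‖Ax - y‖₂²`. -/
def clsLoss (A : Matrix (Fin k) (Fin n) ℝ) (y : E k) (x : E n) : ℝ :=
  1 / 2 * ‖mv A x - y‖ ^ 2

/-- The feasible set `{x | x ≥ 0, 1ᵀx = 1}`. -/
def simplex (n : ℕ) : Set (E n) := {x | x.ofLp ∈ stdSimplex ℝ (Fin n)}

/-- Solutions of the constrained sparse regression problem. -/
def csrSolutions (A : Matrix (Fin k) (Fin n) ℝ) (y : E k) (lam : ℝ) : Set (E n) :=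
  {x | x ∈ simplex n ∧ IsMinOn (csrLoss A y lam) (simplex n) x}

/-- Solutions of the constrained least squares problem. -/
def clsSolutions (A : Matrix (Fin k) (Fin n) ℝ) (y : E k) : Set (E n) :=
  {x | x ∈ simplex n ∧ IsMinOn (clsLoss A y) (simplex n) x}

/-- The nonnegative orthant. -/
def orthant (n : ℕ) : Set (E n) := {x | ∀ i, 0 ≤ x i}

/-- `(1/2)‖Ax - y‖₂² + λ‖x‖₁ + ι_{1}(1ᵀx) + ι_{ℝ₊ⁿ}(x)`. -/
def csrObj (A : Matrix (Fin k) (Fin n) ℝ) (y : E k) (lam : ℝ) (x : E n) : EReal :=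
  (csrLoss A y lam x : EReal) + indic ({1} : Set ℝ) (coordSum x) + indic (orthant n) x

/-- `f₁(x) = (1/2)‖Ax - y‖₂² + ι_{1}(1ᵀx)`. -/
def f1 (A : Matrix (Fin k) (Fin n) ℝ) (y : E k) (x : E n) : EReal :=
  (clsLoss A y x : EReal) + indic ({1} : Set ℝ) (coordSum x)

/-- `f₂(x) = λ‖x‖₁ + ι_{ℝ₊ⁿ}(x)`. -/
def f2 (lam : ℝ) (x : E n) : EReal :=
  ((lam * l1norm x : ℝ) : EReal) + indic (orthant n) x

/-! ### The SUnSAL algorithm -/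

/-- `B = AᵀA + μI`. -/
def matB (A : Matrix (Fin k) (Fin n) ℝ) (μ : ℝ) : Matrix (Fin n) (Fin n) ℝ :=
  Aᵀ * A + μ • (1 : Matrix (Fin n) (Fin n) ℝ)

/-- `C = B⁻¹1 (1ᵀB⁻¹1)⁻¹`. -/
def vecC (A : Matrix (Fin k) (Fin n) ℝ) (μ : ℝ) : E n :=
  (coordSum (mv (matB A μ)⁻¹ (ones n)))⁻¹ • mv (matB A μ)⁻¹ (ones n)

/-- `w = Aᵀy + μ(u + d)`. -/
def vecW (A : Matrix (Fin k) (Fin n) ℝ) (y : E k) (μ : ℝ) (u d : E n) : E n :=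
  mv Aᵀ y + μ • (u + d)

/-- The update `B⁻¹w - C(1ᵀB⁻¹w - 1)`. -/
def xUpdate (A : Matrix (Fin k) (Fin n) ℝ) (y : E k) (μ : ℝ) (u d : E n) : E n :=
  mv (matB A μ)⁻¹ (vecW A y μ u d)
    - (coordSum (mv (matB A μ)⁻¹ (vecW A y μ u d)) - 1) • vecC A μ

/-- Scalar soft threshold `sign(t) max{|t| - τ, 0}`. -/
def soft (t τ : ℝ) : ℝ := Real.sign t * max (|t| - τ) 0

/-- The update `max{0, soft(ν, λ/μ)}`, componentwise. -/
def uUpdate (lam μ : ℝ) (ν : E n) : E n :=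
  WithLp.toLp 2 (fun i => max 0 (soft (ν i) (lam / μ)))

/-- The triple `(x_j, u_j, d_j)`. -/
structure State (n : ℕ) where
  x : E n
  u : E n
  d : E n

/-- One pass through the loop of SUnSAL. -/
def step (A : Matrix (Fin k) (Fin n) ℝ) (y : E k) (lam μ : ℝ) (s : State n) : State n :=
  let x' := xUpdate A y μ s.u s.d
  let u' := uUpdate lam μ (x' - s.d)
  ⟨x', u', s.d - (x' - u')⟩

/-- The SUnSAL iterates. The `x`-component of the initial state is never read. -/
def iterates (A : Matrix (Fin k) (Fin n) ℝ) (y : E k) (lam μ : ℝ) (s₀ : State n) :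
    ℕ → State n
  | 0 => s₀
  | j + 1 => step A y lam μ (iterates A y lam μ s₀ j)

end SUnSAL

end

open SUnSAL

namespace SUnSAL

/-! ### Real-valued functions restricted to a set -/

/-! Every extended-valued function here is a continuous convex real function plus the indicator of a
nonempty closed convex set, so part 1 becomes a statement about real functions on sets. The feasible
set is the compact simplex, which gives existence and coercivity at once.

The closed-form updates satisfy the variational inequalities `IsProxOne` and `IsProxTwo`; these say
that the sub-problem objectives grow quadratically away from the updates, hence unique minimality.
The `ℓ₁` norm causes no difficulty: on the orthant it is the linear function `coordSum`.

Convergence is a Fejér argument. A saddle point `(xs, ds)` exists by explicit multipliers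
(`exists_isSaddle`), and `‖u j - xs‖² + ‖d j - ds‖²` drops by at least `‖x (j+1) - u j‖²` at each
step (`IsSaddle.fejer`). So `(u, d)` is bounded and `x (j+1) - u j → 0`. By continuity of the
updates, a cluster point is a fixed point, hence itself a saddle point. The Fejér quantity centred
there is antitone and vanishes along a subsequence, so it tends to `0`. -/

lemma coe_add_indic_of_mem {X : Type*} {S : Set X} {x : X} (hx : x ∈ S) (a : ℝ) :
    (a : EReal) + indic S x = a := by
  simp [indic, hx]

lemma coe_add_indic_of_notMem {X : Type*} {S : Set X} {x : X} (hx : x ∉ S) (a : ℝ) :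
    (a : EReal) + indic S x = ⊤ := by
  simp [indic, hx]

lemma coe_add_indic_le_coe_iff {X : Type*} {S : Set X} {x : X} {a b : ℝ} :
    (a : EReal) + indic S x ≤ b ↔ x ∈ S ∧ a ≤ b := by
  by_cases hx : x ∈ S
  · simp [coe_add_indic_of_mem hx, hx]
  · simp [coe_add_indic_of_notMem hx, hx]

lemma isProper_coe_add_indic {X : Type*} {S : Set X} (hS : S.Nonempty) (g : X → ℝ) :
    IsProper fun x => (g x : EReal) + indic S x := by
  obtain ⟨s, hs⟩ := hS
  refine ⟨⟨s, by simp [coe_add_indic_of_mem hs]⟩, fun x => ?_⟩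
  by_cases hx : x ∈ S
  · simp [coe_add_indic_of_mem hx]
  · simp [coe_add_indic_of_notMem hx]

lemma isConvexFun_coe_add_indic {n : ℕ} {S : Set (E n)} {g : E n → ℝ} (hg : ConvexOn ℝ S g) :
    IsConvexFun fun x => (g x : EReal) + indic S x := by
  simpa only [IsConvexFun, coe_add_indic_le_coe_iff] using hg.convex_epigraph

lemma lowerSemicontinuous_coe_add_indic {X : Type*} [TopologicalSpace X] {S : Set X}
    (hS : IsClosed S) {g : X → ℝ} (hg : Continuous g) :
    LowerSemicontinuous fun x => (g x : EReal) + indic S x := by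
  intro x a ha
  by_cases hx : x ∈ S
  · simp only [coe_add_indic_of_mem hx] at ha
    have hc : Continuous fun x => (g x : EReal) := continuous_coe_real_ereal.comp hg
    filter_upwards [hc.continuousAt.eventually (lt_mem_nhds ha)] with z hz
    by_cases hzS : z ∈ S
    · simpa [coe_add_indic_of_mem hzS] using hz
    · simpa [coe_add_indic_of_notMem hzS] using hz.trans_le le_top
  · simp only [coe_add_indic_of_notMem hx] at ha
    filter_upwards [hS.isOpen_compl.mem_nhds hx] with z hz
    simpa [coe_add_indic_of_notMem hz] using ha

/-- Nonemptiness of `S` matters: otherwise the function is constantly `⊤` and every point minimizes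
it. -/
lemma argmin_coe_add_indic {X : Type*} {S : Set X} (hS : S.Nonempty) (g : X → ℝ) :
    argmin (fun x => (g x : EReal) + indic S x) = {x | x ∈ S ∧ IsMinOn g S x} := by
  obtain ⟨s, hs⟩ := hS
  ext x
  simp only [argmin, Set.mem_ofPred_eq, isMinOn_iff]
  constructor
  · intro h
    have hx : x ∈ S := by
      have := h s
      rw [coe_add_indic_of_mem hs, coe_add_indic_le_coe_iff] at this
      exact this.1
    refine ⟨hx, fun z hz => ?_⟩
    have := h z
    rw [coe_add_indic_of_mem hz, coe_add_indic_le_coe_iff] at this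
    exact this.2
  · rintro ⟨hx, h⟩ z
    by_cases hz : z ∈ S
    · rw [coe_add_indic_of_mem hz, coe_add_indic_le_coe_iff]
      exact ⟨hx, h z hz⟩
    · rw [coe_add_indic_of_notMem hz]
      exact le_top

/-- Quadratic growth gives minimality and uniqueness together; both ADMM sub-problems supply it with
`c = μ / 2`. -/
lemma argmin_coe_add_indic_eq_singleton {n : ℕ} {S : Set (E n)} {g : E n → ℝ} {x : E n}
    (hx : x ∈ S) {c : ℝ} (hc : 0 < c) (h : ∀ z ∈ S, g x + c * ‖z - x‖ ^ 2 ≤ g z) :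
    argmin (fun x => (g x : EReal) + indic S x) = {x} := by
  rw [argmin_coe_add_indic ⟨x, hx⟩]
  ext z
  simp only [Set.mem_ofPred_eq, Set.mem_singleton_iff, isMinOn_iff]
  constructor
  · rintro ⟨hz, hmin⟩
    have h1 := h z hz
    have h2 := hmin x hx
    have h3 : ‖z - x‖ ^ 2 ≤ 0 := by
      by_contra! h3
      nlinarith [mul_pos hc h3]
    have h4 : ‖z - x‖ = 0 := by nlinarith [sq_nonneg ‖z - x‖]
    exact sub_eq_zero.1 (norm_eq_zero.1 h4)
  · rintro rfl
    refine ⟨hx, fun v hv => ?_⟩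
    have := h v hv
    nlinarith [mul_nonneg hc.le (sq_nonneg ‖v - z‖)]

/-! ### Linear algebra on Euclidean spaces -/

variable {k n p : ℕ}

lemma mv_sub (M : Matrix (Fin p) (Fin n) ℝ) (x z : E n) : mv M (x - z) = mv M x - mv M z := by
  ext i; simp [mv, Matrix.mulVec_sub]

lemma mv_smul (M : Matrix (Fin p) (Fin n) ℝ) (c : ℝ) (x : E n) : mv M (c • x) = c • mv M x := by
  ext i; simp [mv, Matrix.mulVec_smul]

lemma mv_one (x : E n) : mv (1 : Matrix (Fin n) (Fin n) ℝ) x = x := by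
  ext i; simp [mv]

lemma mv_mv {m : ℕ} (M : Matrix (Fin m) (Fin p) ℝ) (N : Matrix (Fin p) (Fin n) ℝ) (x : E n) :
    mv M (mv N x) = mv (M * N) x := by
  ext i; simp [mv]

lemma continuous_mv (M : Matrix (Fin p) (Fin n) ℝ) : Continuous (mv M) := by
  unfold mv
  fun_prop

lemma inner_mv_transpose (M : Matrix (Fin p) (Fin n) ℝ) (a : E p) (b : E n) :
    inner ℝ (mv Mᵀ a) b = inner ℝ a (mv M b) := by
  simp only [mv, EuclideanSpace.inner_eq_star_dotProduct, star_trivial]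
  rw [Matrix.mulVec_transpose, dotProduct_comm, ← Matrix.dotProduct_mulVec, dotProduct_comm]

lemma coordSum_eq_inner (x : E n) : coordSum x = inner ℝ (ones n) x := by
  simp [coordSum, ones, PiLp.inner_apply]

lemma coordSum_sub (x z : E n) : coordSum (x - z) = coordSum x - coordSum z := by
  simp [coordSum]

lemma coordSum_smul (c : ℝ) (x : E n) : coordSum (c • x) = c * coordSum x := by
  simp [coordSum, Finset.mul_sum]

lemma continuous_coordSum : Continuous (coordSum (n := n)) := by
  unfold coordSum
  fun_prop

lemma continuous_l1norm : Continuous (l1norm (n := n)) := by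
  unfold l1norm
  fun_prop

lemma l1norm_eq_coordSum {x : E n} (hx : x ∈ orthant n) : l1norm x = coordSum x :=
  Finset.sum_congr rfl fun i _ => abs_of_nonneg (hx i)

lemma continuous_clsLoss (A : Matrix (Fin k) (Fin n) ℝ) (y : E k) : Continuous (clsLoss A y) := by
  have := continuous_mv A
  unfold clsLoss
  fun_prop

/-- Second-order expansion of the least squares loss. -/
lemma clsLoss_expand (A : Matrix (Fin k) (Fin n) ℝ) (y : E k) (x z : E n) :
    clsLoss A y z = clsLoss A y x + inner ℝ (mv Aᵀ (mv A x - y)) (z - x)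
      + 1 / 2 * ‖mv A (z - x)‖ ^ 2 := by
  have h : mv A z - y = (mv A x - y) + mv A (z - x) := by rw [mv_sub]; abel
  rw [clsLoss, h, norm_add_sq_real, inner_mv_transpose, clsLoss]
  ring

lemma norm_sq_expand (x z s : E n) :
    ‖z - s‖ ^ 2 = ‖x - s‖ ^ 2 + 2 * inner ℝ (x - s) (z - x) + ‖z - x‖ ^ 2 := by
  rw [← norm_add_sq_real]; congr 2; abel

lemma convexOn_l1norm : ConvexOn ℝ Set.univ (l1norm (n := n)) := by
  refine ⟨convex_univ, fun x _ z _ a b ha hb _ => ?_⟩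
  simp only [l1norm, smul_eq_mul, Finset.mul_sum, ← Finset.sum_add_distrib]
  refine Finset.sum_le_sum fun i _ => ?_
  calc |(a • x + b • z) i| ≤ |a * x i| + |b * z i| := by simpa using abs_add_le (a * x i) (b * z i)
    _ = a * |x i| + b * |z i| := by rw [abs_mul, abs_mul, abs_of_nonneg ha, abs_of_nonneg hb]

lemma convexOn_clsLoss (A : Matrix (Fin k) (Fin n) ℝ) (y : E k) :
    ConvexOn ℝ Set.univ (clsLoss A y) := by
  refine ⟨convex_univ, fun x _ z _ a b ha hb hab => ?_⟩
  set m := a • x + b • z with hm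
  -- Expanding around the convex combination `m`, the first-order terms cancel and the quadratic
  -- remainders are nonnegative.
  have h : a * inner ℝ (mv Aᵀ (mv A m - y)) (x - m) + b * inner ℝ (mv Aᵀ (mv A m - y)) (z - m)
      = 0 := by
    rw [← real_inner_smul_right, ← real_inner_smul_right, ← inner_add_right]
    have : a • (x - m) + b • (z - m) = 0 := by
      have : a • (x - m) + b • (z - m) = m - (a + b) • m := by rw [hm]; module
      rw [this, hab, one_smul, sub_self]
    rw [this, inner_zero_right]
  have h2 : a * clsLoss A y m + b * clsLoss A y m = clsLoss A y m := by
    rw [← add_mul, hab, one_mul]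
  simp only [smul_eq_mul]
  rw [clsLoss_expand A y m x, clsLoss_expand A y m z]
  have h3 := mul_nonneg ha (sq_nonneg ‖mv A (x - m)‖)
  have h4 := mul_nonneg hb (sq_nonneg ‖mv A (z - m)‖)
  linarith

/-! ### The constraint sets -/

/-- The affine hyperplane `{x | 1ᵀx = 1}`. -/
def sumOne (n : ℕ) : Set (E n) := {x | coordSum x = 1}

lemma isClosed_sumOne : IsClosed (sumOne n) := isClosed_eq continuous_coordSum continuous_const

lemma convex_sumOne : Convex ℝ (sumOne n) := by
  intro x hx z hz a b _ _ hab
  simp only [sumOne, Set.mem_ofPred_eq, coordSum_eq_inner] at *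
  rw [inner_add_right, real_inner_smul_right, real_inner_smul_right, hx, hz]
  linarith

lemma isClosed_orthant : IsClosed (orthant n) := by
  simp only [orthant, Set.ofPred_forall]
  exact isClosed_iInter fun i => isClosed_le continuous_const (by fun_prop)

lemma convex_orthant : Convex ℝ (orthant n) := by
  intro x hx z hz a b ha hb _ i
  have := add_nonneg (mul_nonneg ha (hx i)) (mul_nonneg hb (hz i))
  simpa using this

lemma mem_simplex_iff {x : E n} : x ∈ simplex n ↔ x ∈ sumOne n ∧ x ∈ orthant n := by
  simp only [simplex, stdSimplex, sumOne, orthant, coordSum, Set.mem_ofPred_eq]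
  exact and_comm

lemma convex_simplex : Convex ℝ (simplex n) := by
  have : simplex n = sumOne n ∩ orthant n := Set.ext fun _ => mem_simplex_iff
  rw [this]
  exact convex_sumOne.inter convex_orthant

lemma single_mem_simplex (i : Fin n) : EuclideanSpace.single i (1 : ℝ) ∈ simplex n := by
  have := single_mem_stdSimplex ℝ i
  simpa [simplex] using this

lemma simplex_nonempty (hn : 1 ≤ n) : (simplex n).Nonempty := ⟨_, single_mem_simplex ⟨0, hn⟩⟩

lemma isCompact_simplex : IsCompact (simplex n) := by
  have : simplex n = (EuclideanSpace.equiv (Fin n) ℝ).toHomeomorph ⁻¹' stdSimplex ℝ (Fin n) := rfl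
  rw [this]
  exact (Homeomorph.isCompact_preimage _).2 (isCompact_stdSimplex ℝ (Fin n))

/-! ### The objective and its splitting -/

lemma f1_eq (A : Matrix (Fin k) (Fin n) ℝ) (y : E k) :
    f1 A y = fun x => (clsLoss A y x : EReal) + indic (sumOne n) x := rfl

lemma f2_eq (lam : ℝ) :
    f2 (n := n) lam = fun x => ((lam * l1norm x : ℝ) : EReal) + indic (orthant n) x := rfl

lemma csrObj_eq (A : Matrix (Fin k) (Fin n) ℝ) (y : E k) (lam : ℝ) :
    csrObj A y lam = fun x => (csrLoss A y lam x : EReal) + indic (simplex n) x := by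
  ext x
  change _ + indic (sumOne n) x + _ = _
  by_cases h1 : x ∈ sumOne n
  · rw [coe_add_indic_of_mem h1]
    by_cases h2 : x ∈ orthant n
    · rw [coe_add_indic_of_mem h2, coe_add_indic_of_mem (mem_simplex_iff.2 ⟨h1, h2⟩)]
    · rw [coe_add_indic_of_notMem h2, coe_add_indic_of_notMem fun h => h2 (mem_simplex_iff.1 h).2]
  · rw [coe_add_indic_of_notMem h1, coe_add_indic_of_notMem fun h => h1 (mem_simplex_iff.1 h).1]
    by_cases h2 : x ∈ orthant n <;> simp [indic, h2]

lemma csrObj_eq_f1_add_f2 (A : Matrix (Fin k) (Fin n) ℝ) (y : E k) (lam : ℝ) (x : E n) :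
    csrObj A y lam x = f1 A y x + f2 lam x := by
  have : (csrLoss A y lam x : EReal) = (clsLoss A y x : EReal) + ((lam * l1norm x : ℝ) : EReal) := by
    rw [← EReal.coe_add]; rfl
  rw [csrObj, f1, f2, this, add_right_comm (clsLoss A y x : EReal), add_assoc]

lemma convexOn_mul_l1norm {lam : ℝ} (hlam : 0 ≤ lam) :
    ConvexOn ℝ Set.univ fun x : E n => lam * l1norm x := convexOn_l1norm.smul hlam

lemma convexOn_csrLoss (A : Matrix (Fin k) (Fin n) ℝ) (y : E k) {lam : ℝ} (hlam : 0 ≤ lam) :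
    ConvexOn ℝ Set.univ (csrLoss A y lam) :=
  (convexOn_clsLoss A y).add (convexOn_mul_l1norm hlam)

lemma continuous_csrLoss (A : Matrix (Fin k) (Fin n) ℝ) (y : E k) (lam : ℝ) :
    Continuous (csrLoss A y lam) :=
  (continuous_clsLoss A y).add (continuous_const.mul continuous_l1norm)

lemma isCoerciveFun_csrObj (A : Matrix (Fin k) (Fin n) ℝ) (y : E k) (lam : ℝ) :
    IsCoerciveFun (csrObj A y lam) := by
  refine tendsto_nhds_of_eventually_eq ?_
  have : (simplex n)ᶜ ∈ Bornology.cobounded (E n) := isCompact_simplex.isBounded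
  filter_upwards [this] with x hx
  rw [csrObj_eq]
  exact coe_add_indic_of_notMem hx _

lemma argmin_csrObj (hn : 1 ≤ n) (A : Matrix (Fin k) (Fin n) ℝ) (y : E k) (lam : ℝ) :
    argmin (csrObj A y lam) = csrSolutions A y lam := by
  rw [csrObj_eq, argmin_coe_add_indic (simplex_nonempty hn)]
  rfl

lemma csrSolutions_nonempty (hn : 1 ≤ n) (A : Matrix (Fin k) (Fin n) ℝ) (y : E k) (lam : ℝ) :
    (csrSolutions A y lam).Nonempty :=
  isCompact_simplex.exists_isMinOn (simplex_nonempty hn) (continuous_csrLoss A y lam).continuousOn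

lemma csrSolutions_zero (A : Matrix (Fin k) (Fin n) ℝ) (y : E k) :
    csrSolutions A y 0 = clsSolutions A y := by
  have : csrLoss A y 0 = clsLoss A y := by
    ext x; simp [csrLoss, clsLoss]
  rw [csrSolutions, clsSolutions, this]

/-! ### The closed-form updates -/

lemma mv_matB (A : Matrix (Fin k) (Fin n) ℝ) (μ : ℝ) (x : E n) :
    mv (matB A μ) x = mv Aᵀ (mv A x) + μ • x := by
  rw [mv_mv]
  ext i
  simp [mv, matB, Matrix.add_mulVec, Matrix.smul_mulVec]

/-- The quadratic form of `B` is `‖Ax‖² + μ‖x‖²`; this positive definiteness yields both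
invertibility claims. -/
lemma mul_norm_sq_le_inner_mv_matB (A : Matrix (Fin k) (Fin n) ℝ) (μ : ℝ) (x : E n) :
    μ * ‖x‖ ^ 2 ≤ inner ℝ (mv (matB A μ) x) x := by
  rw [mv_matB, inner_add_left, inner_mv_transpose, real_inner_smul_left,
    real_inner_self_eq_norm_sq, real_inner_self_eq_norm_sq]
  nlinarith [sq_nonneg ‖mv A x‖]

lemma eq_zero_of_inner_mv_matB (A : Matrix (Fin k) (Fin n) ℝ) {μ : ℝ} (hμ : 0 < μ) {x : E n}
    (h : inner ℝ (mv (matB A μ) x) x = 0) : x = 0 := by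
  have h1 := mul_norm_sq_le_inner_mv_matB A μ x
  rw [h] at h1
  have h2 : ‖x‖ ^ 2 ≤ 0 := by
    by_contra! h2
    nlinarith [mul_pos hμ h2]
  exact norm_eq_zero.1 (by nlinarith [sq_nonneg ‖x‖])

lemma isUnit_matB (A : Matrix (Fin k) (Fin n) ℝ) {μ : ℝ} (hμ : 0 < μ) : IsUnit (matB A μ) := by
  rw [← Matrix.mulVec_injective_iff_isUnit]
  intro a b hab
  have h : mv (matB A μ) (WithLp.toLp 2 a - WithLp.toLp 2 b) = 0 := by
    rw [mv_sub, sub_eq_zero]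
    exact congrArg (WithLp.toLp 2) hab
  have := eq_zero_of_inner_mv_matB A hμ (by rw [h, inner_zero_left])
  exact WithLp.toLp_injective 2 (sub_eq_zero.1 this)

lemma mv_matB_inv (A : Matrix (Fin k) (Fin n) ℝ) {μ : ℝ} (hμ : 0 < μ) (x : E n) :
    mv (matB A μ) (mv (matB A μ)⁻¹ x) = x := by
  rw [mv_mv, Matrix.mul_nonsing_inv _ ((Matrix.isUnit_iff_isUnit_det _).1 (isUnit_matB A hμ)),
    mv_one]

/-- With `v = B⁻¹1`, the sum is `⟨Bv, v⟩`; if it vanished, then `v = 0` and `1 = Bv = 0`, impossible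
for `n ≥ 1`. -/
lemma coordSum_mv_matB_inv_ones_ne_zero (hn : 1 ≤ n) (A : Matrix (Fin k) (Fin n) ℝ) {μ : ℝ}
    (hμ : 0 < μ) : coordSum (mv (matB A μ)⁻¹ (ones n)) ≠ 0 := by
  intro h
  rw [coordSum_eq_inner] at h
  nth_rewrite 1 [← mv_matB_inv A hμ (ones n)] at h
  have h0 := eq_zero_of_inner_mv_matB A hμ h
  have h1 := mv_matB_inv A hμ (ones n)
  rw [h0] at h1
  have h2 := congrArg (fun v : E n => v ⟨0, hn⟩) h1
  simp [mv, ones] at h2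

/-- `x` is the proximal point of `f₁` at `s`: `μ (s - x)` is a subgradient of `f₁` at `x`. -/
def IsProxOne (A : Matrix (Fin k) (Fin n) ℝ) (y : E k) (μ : ℝ) (s x : E n) : Prop :=
  x ∈ sumOne n ∧ ∀ z ∈ sumOne n, 0 ≤ inner ℝ (mv Aᵀ (mv A x - y) + μ • (x - s)) (z - x)

/-- `u` is the proximal point of `f₂` at `t`: `μ (t - u)` is a subgradient of `f₂` at `u`. -/
def IsProxTwo (lam μ : ℝ) (t u : E n) : Prop :=
  u ∈ orthant n ∧ ∀ v ∈ orthant n, 0 ≤ inner ℝ (lam • ones n + μ • (u - t)) (v - u)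

lemma isProxOne_xUpdate (hn : 1 ≤ n) (A : Matrix (Fin k) (Fin n) ℝ) (y : E k) {μ : ℝ}
    (hμ : 0 < μ) (u d : E n) : IsProxOne A y μ (u + d) (xUpdate A y μ u d) := by
  have hne := coordSum_mv_matB_inv_ones_ne_zero hn A hμ
  have hsum : coordSum (xUpdate A y μ u d) = 1 := by
    rw [xUpdate, vecC, coordSum_sub, coordSum_smul, coordSum_smul, inv_mul_cancel₀ hne]
    ring
  -- Here `c` is the Lagrange multiplier of `1ᵀx = 1`: the gradient is a multiple of the all-ones
  -- vector, hence orthogonal to differences of points of the hyperplane.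
  obtain ⟨c, hc⟩ : ∃ c : ℝ, mv (matB A μ) (xUpdate A y μ u d) = vecW A y μ u d - c • ones n := by
    refine ⟨(coordSum (mv (matB A μ)⁻¹ (vecW A y μ u d)) - 1)
      * (coordSum (mv (matB A μ)⁻¹ (ones n)))⁻¹, ?_⟩
    rw [xUpdate, vecC, mv_sub, mv_smul, mv_smul, mv_matB_inv A hμ, mv_matB_inv A hμ, smul_smul]
  refine ⟨hsum, fun z hz => le_of_eq ?_⟩
  have hgrad : mv Aᵀ (mv A (xUpdate A y μ u d) - y) + μ • (xUpdate A y μ u d - (u + d))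
      = -c • ones n := by
    rw [mv_matB, vecW] at hc
    rw [mv_sub, smul_sub, sub_add_sub_comm, hc]
    module
  rw [hgrad, real_inner_smul_left, ← coordSum_eq_inner, coordSum_sub, hsum,
    show coordSum z = 1 from hz]
  simp

lemma max_zero_soft {t τ : ℝ} (hτ : 0 ≤ τ) : max 0 (soft t τ) = max 0 (t - τ) := by
  unfold soft
  rcases lt_trichotomy t 0 with h | h | h
  · rw [Real.sign_of_neg h, max_eq_left, max_eq_left]
    · linarith
    · nlinarith [le_max_right (|t| - τ) 0]
  · subst h
    simp [hτ]
  · rw [Real.sign_of_pos h, abs_of_pos h, one_mul, max_comm (t - τ), ← max_assoc, max_self]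

lemma uUpdate_eq {lam μ : ℝ} (hlam : 0 ≤ lam) (hμ : 0 < μ) (t : E n) :
    uUpdate lam μ t = WithLp.toLp 2 (fun i => max 0 (t i - lam / μ)) := by
  unfold uUpdate
  simp only [max_zero_soft (div_nonneg hlam hμ.le)]

lemma isProxTwo_uUpdate {lam μ : ℝ} (hlam : 0 ≤ lam) (hμ : 0 < μ) (t : E n) :
    IsProxTwo lam μ t (uUpdate lam μ t) := by
  rw [uUpdate_eq hlam hμ]
  refine ⟨fun i => le_max_left _ _, fun v hv => ?_⟩
  simp only [PiLp.inner_apply]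
  refine Finset.sum_nonneg fun i _ => ?_
  have hv := hv i
  have hl : lam = μ * (lam / μ) := by field_simp
  generalize lam / μ = τ at *
  simp only [ones, PiLp.add_apply, PiLp.smul_apply, PiLp.sub_apply, smul_eq_mul, mul_one,
    RCLike.inner_apply, conj_trivial]
  rw [hl]
  -- Complementarity: either the coordinate of `u` is `0` and its gradient entry `μ (τ - t i)` is
  -- nonnegative, or that entry vanishes.
  rcases le_total (t i - τ) 0 with h | h
  · rw [max_eq_left h]
    nlinarith [mul_nonneg hμ.le (mul_nonneg hv (sub_nonneg.2 h))]
  · rw [max_eq_right h]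
    apply le_of_eq
    ring

lemma continuous_uUpdate {lam μ : ℝ} (hlam : 0 ≤ lam) (hμ : 0 < μ) :
    Continuous (uUpdate (n := n) lam μ) := by
  simp only [funext (uUpdate_eq (n := n) hlam hμ)]
  fun_prop

lemma continuous_xUpdate (A : Matrix (Fin k) (Fin n) ℝ) (y : E k) (μ : ℝ) :
    Continuous fun q : E n × E n => xUpdate A y μ q.1 q.2 := by
  have h1 := continuous_mv (matB A μ)⁻¹
  have h2 := continuous_coordSum (n := n)
  unfold xUpdate vecW
  fun_prop

lemma tendsto_xUpdate {ι : Type*} {l : Filter ι} (A : Matrix (Fin k) (Fin n) ℝ) (y : E k) (μ : ℝ)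
    {u d : ι → E n} {ub db : E n} (hu : Tendsto u l (𝓝 ub)) (hd : Tendsto d l (𝓝 db)) :
    Tendsto (fun j => xUpdate A y μ (u j) (d j)) l (𝓝 (xUpdate A y μ ub db)) := by
  have h := continuous_xUpdate A y μ
  generalize xUpdate A y μ = g at h ⊢
  exact (h.tendsto (ub, db)).comp (hu.prodMk_nhds hd)

lemma IsProxOne.clsLoss_add_le {A : Matrix (Fin k) (Fin n) ℝ} {y : E k} {μ : ℝ} {s x : E n}
    (h : IsProxOne A y μ s x) {z : E n} (hz : z ∈ sumOne n) :
    clsLoss A y x + μ * inner ℝ (s - x) (z - x) ≤ clsLoss A y z := by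
  have h1 := h.2 z hz
  rw [inner_add_left, real_inner_smul_left, ← neg_sub s x, inner_neg_left] at h1
  rw [clsLoss_expand A y x z]
  nlinarith [sq_nonneg ‖mv A (z - x)‖]

/-- Since `l1norm` agrees with `coordSum` on the orthant, `lam • ones n` acts as the gradient of the
penalty there. -/
lemma IsProxTwo.l1norm_add_le {lam μ : ℝ} {t u : E n} (h : IsProxTwo lam μ t u) {v : E n}
    (hv : v ∈ orthant n) :
    lam * l1norm u + μ * inner ℝ (t - u) (v - u) ≤ lam * l1norm v := by
  have h1 := h.2 v hv
  rw [inner_add_left, real_inner_smul_left, real_inner_smul_left, ← neg_sub t u, inner_neg_left,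
    ← coordSum_eq_inner, coordSum_sub, ← l1norm_eq_coordSum hv, ← l1norm_eq_coordSum h.1] at h1
  linarith

lemma coe_add_indic_add_coe {X : Type*} (g h : X → ℝ) (S : Set X) :
    (fun x => ((g x : EReal) + indic S x) + ((h x : ℝ) : EReal))
      = fun x => ((g x + h x : ℝ) : EReal) + indic S x := by
  ext x
  rw [EReal.coe_add, add_right_comm]

/-- Expanding the squared norm at `x`, its linear term cancels the subgradient term and leaves the
growth `μ/2 ‖z - x‖²`. -/
lemma IsProxOne.argmin_admmXObj {A : Matrix (Fin k) (Fin n) ℝ} {y : E k} {μ : ℝ} (hμ : 0 < μ)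
    {u d x : E n} (h : IsProxOne A y μ (u + d) x) : argmin (admmXObj (f1 A y) 1 μ u d) = {x} := by
  have he : admmXObj (f1 A y) 1 μ u d = fun z =>
      ((clsLoss A y z + μ / 2 * ‖z - u - d‖ ^ 2 : ℝ) : EReal) + indic (sumOne n) z := by
    rw [← coe_add_indic_add_coe]
    ext z
    rw [admmXObj, mv_one]
    rfl
  rw [he]
  refine argmin_coe_add_indic_eq_singleton h.1 (half_pos hμ) fun z hz => ?_
  have h1 := h.clsLoss_add_le hz
  have h2 := norm_sq_expand x z (u + d)
  rw [← neg_sub x, inner_neg_left] at h1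
  rw [sub_sub, sub_sub, h2]
  linarith

lemma IsProxTwo.argmin_admmUObj {lam μ : ℝ} (hμ : 0 < μ) {x d u : E n}
    (h : IsProxTwo lam μ (x - d) u) : argmin (admmUObj (f2 lam) 1 μ x d) = {u} := by
  have he : admmUObj (f2 lam) 1 μ x d = fun v =>
      ((lam * l1norm v + μ / 2 * ‖x - v - d‖ ^ 2 : ℝ) : EReal) + indic (orthant n) v := by
    rw [← coe_add_indic_add_coe]
    ext v
    rw [admmUObj, mv_one]
    rfl
  rw [he]
  refine argmin_coe_add_indic_eq_singleton h.1 (half_pos hμ) fun v hv => ?_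
  have h1 := h.l1norm_add_le hv
  have h2 := norm_sq_expand u v (x - d)
  rw [← neg_sub u, inner_neg_left] at h1
  rw [sub_right_comm, sub_right_comm x v, norm_sub_rev _ u, norm_sub_rev _ v, h2]
  linarith

/-! ### Saddle points -/

/-- `(x, d)` is a primal-dual solution: `μ d ∈ ∂f₁(x)` and `-μ d ∈ ∂f₂(x)`. -/
def IsSaddle (A : Matrix (Fin k) (Fin n) ℝ) (y : E k) (lam μ : ℝ) (x d : E n) : Prop :=
  IsProxOne A y μ (x + d) x ∧ IsProxTwo lam μ (x - d) x

/-- Adding the two subgradient inequalities cancels the terms in `μ d` and `-μ d`. -/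
lemma IsSaddle.mem_csrSolutions {A : Matrix (Fin k) (Fin n) ℝ} {y : E k} {lam μ : ℝ} {x d : E n}
    (h : IsSaddle A y lam μ x d) : x ∈ csrSolutions A y lam := by
  refine ⟨mem_simplex_iff.2 ⟨h.1.1, h.2.1⟩, isMinOn_iff.2 fun z hz => ?_⟩
  obtain ⟨hz1, hz2⟩ := mem_simplex_iff.1 hz
  have h1 := h.1.clsLoss_add_le hz1
  have h2 := h.2.l1norm_add_le hz2
  rw [add_sub_cancel_left] at h1
  rw [sub_sub_cancel_left, inner_neg_left] at h2
  change clsLoss A y x + lam * l1norm x ≤ clsLoss A y z + lam * l1norm z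
  linarith

/-- First-order optimality on the simplex. -/
lemma inner_gradient_nonneg {A : Matrix (Fin k) (Fin n) ℝ} {y : E k} {lam : ℝ} {x z : E n}
    (hx : x ∈ csrSolutions A y lam) (hz : z ∈ simplex n) :
    0 ≤ inner ℝ (mv Aᵀ (mv A x - y)) (z - x) := by
  obtain ⟨hxS, hmin⟩ := hx
  -- The penalty is constant on the simplex, so only the least squares gradient enters.
  have hl : ∀ v ∈ simplex n, csrLoss A y lam v = clsLoss A y v + lam := by
    intro v hv
    obtain ⟨h1, h2⟩ := mem_simplex_iff.1 hv
    change clsLoss A y v + lam * l1norm v = _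
    rw [l1norm_eq_coordSum h2, show coordSum v = 1 from h1, mul_one]
  set a := inner ℝ (mv Aᵀ (mv A x - y)) (z - x) with ha
  set b := ‖mv A (z - x)‖ ^ 2 with hb
  -- Compare `x` with `x + t (z - x)`, divide by `t`, then let `t` decrease to `0`.
  have key : ∀ t : ℝ, 0 < t → t ≤ 1 → 0 ≤ a + t * (b / 2) := by
    intro t ht0 ht1
    have hmem := convex_simplex.add_smul_sub_mem hxS hz ⟨ht0.le, ht1⟩
    have h := isMinOn_iff.1 hmin _ hmem
    rw [hl _ hmem, hl _ hxS, clsLoss_expand A y x (x + _), add_sub_cancel_left, real_inner_smul_right,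
      mv_smul, norm_smul, mul_pow, Real.norm_eq_abs, sq_abs, ← ha, ← hb] at h
    have : 0 ≤ t * (a + t * (b / 2)) := by linarith
    exact nonneg_of_mul_nonneg_right this ht0
  have ht : Tendsto (fun t : ℝ => a + t * (b / 2)) (𝓝[>] 0) (𝓝 (a + 0 * (b / 2))) :=
    ((by fun_prop : Continuous fun t : ℝ => a + t * (b / 2)).tendsto 0).mono_left
      nhdsWithin_le_nhds
  rw [zero_mul, add_zero] at ht
  refine ge_of_tendsto ht ?_
  filter_upwards [Ioc_mem_nhdsGT (zero_lt_one (α := ℝ))] with t ht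
  exact key t ht.1 ht.2

lemma exists_isSaddle {A : Matrix (Fin k) (Fin n) ℝ} {y : E k} {lam μ : ℝ} (hμ : 0 < μ)
    {x : E n} (hx : x ∈ csrSolutions A y lam) : ∃ d, IsSaddle A y lam μ x d := by
  obtain ⟨hx1, hx2⟩ := mem_simplex_iff.1 hx.1
  set q := mv Aᵀ (mv A x - y) with hq
  -- This value of `θ` makes `lam • ones n + q - θ • ones n` orthogonal to `x` (as `1ᵀx = 1`). Its
  -- coordinates are `q i - ⟨q, x⟩`, nonnegative by optimality of `x` against the simplex vertices.
  set θ := inner ℝ q x + lam with hθ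
  have hd : μ • (μ⁻¹ • (q - θ • ones n)) = q - θ • ones n := by
    rw [smul_inv_smul₀ hμ.ne']
  refine ⟨μ⁻¹ • (q - θ • ones n), ⟨hx1, fun z hz => ?_⟩, hx2, fun v hv => ?_⟩
  · rw [sub_add_cancel_left, smul_neg, hd, ← hq, neg_sub, add_sub_cancel, real_inner_smul_left,
      ← coordSum_eq_inner, coordSum_sub, show coordSum z = 1 from hz,
      show coordSum x = 1 from hx1]
    simp
  · rw [sub_sub_cancel, hd]
    have hx0 : inner ℝ (lam • ones n + (q - θ • ones n)) x = 0 := by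
      rw [inner_add_left, inner_sub_left, real_inner_smul_left, real_inner_smul_left,
        ← coordSum_eq_inner, show coordSum x = 1 from hx1, hθ]
      ring
    rw [inner_sub_right, hx0, sub_zero, PiLp.inner_apply]
    refine Finset.sum_nonneg fun i _ => ?_
    have h := inner_gradient_nonneg hx (single_mem_simplex i)
    rw [inner_sub_right, ← hq, EuclideanSpace.inner_single_right] at h
    simp only [ones, PiLp.add_apply, PiLp.smul_apply, PiLp.sub_apply, smul_eq_mul, mul_one,
      RCLike.inner_apply, conj_trivial]
    have hq' : 0 ≤ q i - inner ℝ q x := by simpa using h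
    exact mul_nonneg (hv i) (by rw [hθ]; linarith)

/-! ### Convergence -/

/-- Fejér monotonicity of the iteration with respect to saddle points. -/
lemma IsSaddle.fejer {A : Matrix (Fin k) (Fin n) ℝ} {y : E k} {lam μ : ℝ} (hμ : 0 < μ)
    {xs ds u d x' u' d' : E n} (h : IsSaddle A y lam μ xs ds) (hx : IsProxOne A y μ (u + d) x')
    (hu : IsProxTwo lam μ (x' - d) u') (hd : d' = d - (x' - u')) :
    ‖u' - xs‖ ^ 2 + ‖d' - ds‖ ^ 2 + ‖x' - u‖ ^ 2 ≤ ‖u - xs‖ ^ 2 + ‖d - ds‖ ^ 2 := by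
  have a1 := hx.clsLoss_add_le h.1.1
  have a2 := h.1.clsLoss_add_le hx.1
  have b1 := hu.l1norm_add_le h.2.1
  have b2 := h.2.l1norm_add_le hu.1
  -- Summing the four inequalities cancels all function values: this is monotonicity of the two
  -- subdifferentials.
  have key : 0 ≤ μ * (-(inner ℝ (u + d - x') (xs - x') + inner ℝ (xs + ds - xs) (x' - xs)
      + inner ℝ (x' - d - u') (xs - u') + inner ℝ (xs - ds - xs) (u' - xs))) := by linarith
  have key := nonneg_of_mul_nonneg_right key hμ
  -- After translating by the saddle point, `ds` drops out of `key`, and the gap in the goal is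
  -- exactly twice the right side of `key`.
  obtain ⟨a, rfl⟩ : ∃ a, u' = xs + a := ⟨u' - xs, by abel⟩
  obtain ⟨b, rfl⟩ : ∃ b, d = ds + b := ⟨d - ds, by abel⟩
  obtain ⟨c, rfl⟩ : ∃ c, x' = xs + c := ⟨x' - xs, by abel⟩
  obtain ⟨e, rfl⟩ : ∃ e, u = xs + e := ⟨u - xs, by abel⟩
  subst hd
  rw [show xs + e + (ds + b) - (xs + c) = e + ds + b - c by abel, show xs - (xs + c) = -c by abel,
    show xs + ds - xs = ds by abel, show xs + c - xs = c by abel,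
    show xs + c - (ds + b) - (xs + a) = c - ds - b - a by abel, show xs - (xs + a) = -a by abel,
    show xs - ds - xs = -ds by abel, show xs + a - xs = a by abel] at key
  rw [show xs + a - xs = a by abel, show ds + b - (xs + c - (xs + a)) - ds = b - c + a by abel,
    show xs + c - (xs + e) = c - e by abel, show xs + e - xs = e by abel,
    show ds + b - ds = b by abel]
  simp only [← real_inner_self_eq_norm_sq, inner_add_left, inner_sub_left, inner_add_right,
    inner_sub_right, inner_neg_left, inner_neg_right] at key ⊢
  linarith [real_inner_comm c a, real_inner_comm c b, real_inner_comm b a, real_inner_comm e c,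
    real_inner_comm ds a, real_inner_comm ds c]

lemma isSaddle_of_fixed (hn : 1 ≤ n) (A : Matrix (Fin k) (Fin n) ℝ) (y : E k) {lam μ : ℝ}
    (hlam : 0 ≤ lam) (hμ : 0 < μ) {x d : E n} (h1 : xUpdate A y μ x d = x)
    (h2 : uUpdate lam μ (x - d) = x) : IsSaddle A y lam μ x d := by
  have h3 := isProxOne_xUpdate hn A y hμ x d
  have h4 := isProxTwo_uUpdate hlam hμ (x - d)
  rw [h1] at h3
  rw [h2] at h4
  exact ⟨h3, h4⟩

/-- An antitone sequence bounded below converges, so its successive decreases, which dominate `‖r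
j‖²`, tend to `0`. -/
lemma tendsto_zero_of_sq_norm_le {V : ℕ → ℝ} {r : ℕ → E n} (hV : ∀ j, 0 ≤ V j)
    (h : ∀ j, V (j + 1) + ‖r j‖ ^ 2 ≤ V j) : Tendsto r atTop (𝓝 0) := by
  have hanti : Antitone V := antitone_nat_of_succ_le fun j => by
    linarith [h j, sq_nonneg ‖r j‖]
  have hl := tendsto_atTop_ciInf hanti ⟨0, by rintro _ ⟨j, rfl⟩; exact hV j⟩
  have hsub := hl.sub (hl.comp (tendsto_add_atTop_nat 1))
  rw [sub_self] at hsub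
  have hsq : Tendsto (fun j => ‖r j‖ ^ 2) atTop (𝓝 0) :=
    squeeze_zero (fun j => sq_nonneg _)
      (fun j => by simp only [Function.comp]; linarith [h j]) hsub
  rw [tendsto_zero_iff_norm_tendsto_zero]
  simpa using hsq.sqrt

/-- The sequences generated by the closed-form updates converge to a solution. -/
theorem exists_tendsto_of_updates {A : Matrix (Fin k) (Fin n) ℝ} {y : E k} {lam μ : ℝ} (hn : 1 ≤ n)
    (hlam : 0 ≤ lam) (hμ : 0 < μ) {x u d : ℕ → E n}
    (hx : ∀ j, x (j + 1) = xUpdate A y μ (u j) (d j))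
    (hu : ∀ j, u (j + 1) = uUpdate lam μ (x (j + 1) - d j))
    (hd : ∀ j, d (j + 1) = d j - (x (j + 1) - u (j + 1))) :
    ∃ xs ∈ csrSolutions A y lam, Tendsto x atTop (𝓝 xs) ∧ Tendsto u atTop (𝓝 xs) := by
  have hpx : ∀ j, IsProxOne A y μ (u j + d j) (x (j + 1)) := fun j => by
    rw [hx]; exact isProxOne_xUpdate hn A y hμ _ _
  have hpu : ∀ j, IsProxTwo lam μ (x (j + 1) - d j) (u (j + 1)) := fun j => by
    rw [hu]; exact isProxTwo_uUpdate hlam hμ _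
  have hfejer : ∀ {xs ds}, IsSaddle A y lam μ xs ds → ∀ j,
      ‖u (j + 1) - xs‖ ^ 2 + ‖d (j + 1) - ds‖ ^ 2 + ‖x (j + 1) - u j‖ ^ 2
        ≤ ‖u j - xs‖ ^ 2 + ‖d j - ds‖ ^ 2 :=
    fun h j => h.fejer hμ (hpx j) (hpu j) (hd j)
  have hanti : ∀ {xs ds}, IsSaddle A y lam μ xs ds →
      Antitone fun j => ‖u j - xs‖ ^ 2 + ‖d j - ds‖ ^ 2 := fun h =>
    antitone_nat_of_succ_le fun j => by
      have := hfejer h j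
      linarith [sq_nonneg ‖x (j + 1) - u j‖]
  obtain ⟨x₀, hx₀⟩ := csrSolutions_nonempty hn A y lam
  obtain ⟨d₀, hs₀⟩ := exists_isSaddle hμ hx₀
  have hlim : Tendsto (fun j => x (j + 1) - u j) atTop (𝓝 0) := tendsto_zero_of_sq_norm_le
    (V := fun j => ‖u j - x₀‖ ^ 2 + ‖d j - d₀‖ ^ 2) (fun j => add_nonneg (sq_nonneg _) (sq_nonneg _)) (hfejer hs₀)
  obtain ⟨⟨ub, db⟩, -, φ, hφ, hcl⟩ := tendsto_subseq_of_bounded (x := fun j => (u j, d j))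
    (s := Metric.closedBall (x₀, d₀) (Real.sqrt (‖u 0 - x₀‖ ^ 2 + ‖d 0 - d₀‖ ^ 2)))
    Metric.isBounded_closedBall (fun j => by
      have h := hanti hs₀ (Nat.zero_le j)
      simp only at h
      rw [Metric.mem_closedBall, Prod.dist_eq, dist_eq_norm, dist_eq_norm]
      refine max_le (Real.le_sqrt_of_sq_le ?_) (Real.le_sqrt_of_sq_le ?_)
      · linarith [sq_nonneg ‖d j - d₀‖]
      · linarith [sq_nonneg ‖u j - x₀‖])
  have hub : Tendsto (fun j => u (φ j)) atTop (𝓝 ub) := (continuous_fst.tendsto _).comp hcl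
  have hdb : Tendsto (fun j => d (φ j)) atTop (𝓝 db) := (continuous_snd.tendsto _).comp hcl
  have hsad : IsSaddle A y lam μ ub db := by
    refine isSaddle_of_fixed hn A y hlam hμ ?_ ?_
    · have h1 : Tendsto (fun j => x (φ j + 1)) atTop (𝓝 (xUpdate A y μ ub db)) := by
        simp only [hx]
        exact tendsto_xUpdate A y μ hub hdb
      have h2 : Tendsto (fun j => x (φ j + 1)) atTop (𝓝 ub) := by
        simpa using (hlim.comp hφ.tendsto_atTop).add hub
      exact tendsto_nhds_unique h1 h2
    · have h1 : Tendsto (fun j => uUpdate lam μ (u (φ j) - d (φ j))) atTop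
          (𝓝 (uUpdate lam μ (ub - db))) :=
        ((continuous_uUpdate hlam hμ).tendsto _).comp (hub.sub hdb)
      have h2 : Tendsto (fun j => uUpdate lam μ (u (φ j) - d (φ j))) atTop (𝓝 ub) := by
        refine hub.congr' ?_
        -- The dual update gives `u (i+1) - d (i+1) = x (i+1) - d i`, so `u` at any index is the
        -- update of `u - d` at that same index. Index `0` is excluded because the initial data are
        -- arbitrary.
        filter_upwards [hφ.tendsto_atTop.eventually_ge_atTop 1] with j hj
        obtain ⟨i, hi⟩ := Nat.exists_eq_add_of_le' hj
        have : u (i + 1) - d (i + 1) = x (i + 1) - d i := by rw [hd i]; abel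
        rw [hi, this, hu]
      exact tendsto_nhds_unique h1 h2
  -- The Fejér quantity is now recentred at the cluster point, so subsequential convergence upgrades
  -- to full convergence.
  have hV : Tendsto (fun j => ‖u j - ub‖ ^ 2 + ‖d j - db‖ ^ 2) atTop (𝓝 0) := by
    refine (tendsto_iff_tendsto_subseq_of_antitone (hanti hsad) hφ.tendsto_atTop).2 ?_
    have := ((hub.sub_const ub).norm.pow 2).add ((hdb.sub_const db).norm.pow 2)
    simpa [Function.comp_def] using this
  have hu_lim : Tendsto u atTop (𝓝 ub) := by
    rw [tendsto_iff_norm_sub_tendsto_zero]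
    have hsq : Tendsto (fun j => ‖u j - ub‖ ^ 2) atTop (𝓝 0) :=
      squeeze_zero (fun j => sq_nonneg _) (fun j => by linarith [sq_nonneg ‖d j - db‖]) hV
    simpa using hsq.sqrt
  refine ⟨ub, hsad.mem_csrSolutions, ?_, hu_lim⟩
  rw [← tendsto_add_atTop_iff_nat 1]
  simpa using hlim.add hu_lim

end SUnSAL

theorem mainTheorem1 {k n : ℕ} (hn : 1 ≤ n) (A : Matrix (Fin k) (Fin n) ℝ)
    (y : EuclideanSpace ℝ (Fin k)) (lam μ : ℝ) (hlam : 0 ≤ lam) (hμ : 0 < μ) :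
    -- the objective is proper, convex, lower semicontinuous and coercive, and has a minimizer
    (IsProper (csrObj A y lam) ∧ IsConvexFun (csrObj A y lam) ∧
      LowerSemicontinuous (csrObj A y lam) ∧ IsCoerciveFun (csrObj A y lam)) ∧
    (argmin (csrObj A y lam)).Nonempty ∧
    -- its minimizers are the solutions of the constrained problem; CLS is the case `lam = 0`
    argmin (csrObj A y lam) = csrSolutions A y lam ∧
    (lam = 0 → csrSolutions A y lam = clsSolutions A y) ∧
    -- the splitting used by ADMM, with `G = I`
    (∀ x : E n, csrObj A y lam x = f1 A y x + f2 lam (mv (1 : Matrix (Fin n) (Fin n) ℝ) x)) ∧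
    (IsProper (f1 A y) ∧ IsConvexFun (f1 A y) ∧ LowerSemicontinuous (f1 A y)) ∧
    (IsProper (f2 (n := n) lam) ∧ IsConvexFun (f2 (n := n) lam) ∧
      LowerSemicontinuous (f2 (n := n) lam)) ∧
    -- the closed-form updates are well defined and are the exact sub-problem solutions
    IsUnit (matB A μ) ∧ coordSum (mv (matB A μ)⁻¹ (ones n)) ≠ 0 ∧
    (∀ u d : E n, argmin (admmXObj (f1 A y) 1 μ u d) = {xUpdate A y μ u d}) ∧
    (∀ x d : E n, argmin (admmUObj (f2 lam) 1 μ x d) = {uUpdate lam μ (x - d)}) ∧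
    -- SUnSAL is ADMM, and its iterates converge to a minimizer
    ∀ s₀ : State n,
      IsADMM (f1 A y) (f2 lam) 1 μ (fun j => (iterates A y lam μ s₀ j).x)
        (fun j => (iterates A y lam μ s₀ j).u) (fun j => (iterates A y lam μ s₀ j).d) ∧
      ∃ xs ∈ argmin (csrObj A y lam),
        Filter.Tendsto (fun j => (iterates A y lam μ s₀ j).x) Filter.atTop (nhds xs) ∧
        Filter.Tendsto (fun j => (iterates A y lam μ s₀ j).u) Filter.atTop (nhds xs) := by
  refine ⟨⟨?_, ?_, ?_, isCoerciveFun_csrObj A y lam⟩, ?_, argmin_csrObj hn A y lam, ?_,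
    fun x => ?_, ⟨?_, ?_, ?_⟩, ⟨?_, ?_, ?_⟩, isUnit_matB A hμ,
    coordSum_mv_matB_inv_ones_ne_zero hn A hμ,
    fun u d => (isProxOne_xUpdate hn A y hμ u d).argmin_admmXObj hμ,
    fun x d => (isProxTwo_uUpdate hlam hμ (x - d)).argmin_admmUObj hμ, fun s₀ => ⟨⟨fun j => ?_,
      fun j => ?_, fun j => ?_⟩, ?_⟩⟩
  · rw [csrObj_eq]
    exact isProper_coe_add_indic (simplex_nonempty hn) _
  · rw [csrObj_eq]
    exact isConvexFun_coe_add_indic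
      ((convexOn_csrLoss A y hlam).subset (Set.subset_univ _) convex_simplex)
  · rw [csrObj_eq]
    exact lowerSemicontinuous_coe_add_indic isCompact_simplex.isClosed (continuous_csrLoss A y lam)
  · rw [argmin_csrObj hn]
    exact csrSolutions_nonempty hn A y lam
  · rintro rfl
    exact csrSolutions_zero A y
  · rw [mv_one, csrObj_eq_f1_add_f2]
  · rw [f1_eq]
    exact isProper_coe_add_indic ((simplex_nonempty hn).mono fun x hx => (mem_simplex_iff.1 hx).1) _
  · rw [f1_eq]
    exact isConvexFun_coe_add_indic
      ((convexOn_clsLoss A y).subset (Set.subset_univ _) convex_sumOne)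
  · rw [f1_eq]
    exact lowerSemicontinuous_coe_add_indic isClosed_sumOne (continuous_clsLoss A y)
  · rw [f2_eq]
    exact isProper_coe_add_indic ((simplex_nonempty hn).mono fun x hx => (mem_simplex_iff.1 hx).2) _
  · rw [f2_eq]
    exact isConvexFun_coe_add_indic
      ((convexOn_mul_l1norm hlam).subset (Set.subset_univ _) convex_orthant)
  · rw [f2_eq]
    exact lowerSemicontinuous_coe_add_indic isClosed_orthant
      (continuous_const.mul continuous_l1norm)
  · rw [(isProxOne_xUpdate hn A y hμ _ _).argmin_admmXObj hμ]
    rfl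
  · rw [(isProxTwo_uUpdate hlam hμ _).argmin_admmUObj hμ]
    rfl
  · rw [mv_one]
    rfl
  · rw [argmin_csrObj hn]
    exact exists_tendsto_of_updates hn hlam hμ (d := fun j => (iterates A y lam μ s₀ j).d)
      (fun _ => rfl) (fun _ => rfl) (fun _ => rfl)
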